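/- A similarity of $\mathbb{R}^3$ is a map $f(x)=\lambda Qx+b$ with $0\neq\lambda\in\mathbb{R}$, $b\in\mathbb{R}^3$ and $Q\in\mathbb{R}^{3\times 3}$ satisfying $Q^{T}Q=I$, $\det Q=1$. An irreducible algebraic space curve is an irreducible real algebraic subset of $\mathbb{R}^3$ of dimension one (it may be planar). Such a curve $\mathcal{C}$ is called symmetric if there is an isometry $g\neq\mathrm{id}$ of $\mathbb{R}^3$ with $g(\mathcal{C})=\mathcal{C}$. Let $\mathcal{C}_1,\mathcal{C}_2\subset\mathbb{R}^3$ be irreducible algebraic space curves, neither of which is a line or a circle, and suppose that they are similar, i.e. that $f(\mathcal{C}_1)=\mathcal{C}_2$ for some similarity $f$. Then there are only finitely many similarities $f$ with $f(\mathcal{C}_1)=\mathcal{C}_2$. Moreover, such a similarity is unique if and only if neither $\mathcal{C}_1$ nor $\mathcal{C}_2$ is symmetric. -/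

import Mathlib

/-- Euclidean three-space. -/
abbrev Space3 : Type := EuclideanSpace ℝ (Fin 3)

/-- A (real) algebraic set: the common zeros in three-space of a set of real polynomials. -/
def IsAlgebraicSet (C : Set Space3) : Prop :=
  ∃ S : Set (MvPolynomial (Fin 3) ℝ), C = {x : Space3 | ∀ p ∈ S, MvPolynomial.eval (⇑x) p = 0}

/-- Irreducibility in the Zariski topology: nonempty, and not covered by two algebraic sets
unless one of them already covers it. -/
def IsZariskiIrreducible (C : Set Space3) : Prop :=
  C.Nonempty ∧ ∀ A B : Set Space3, IsAlgebraicSet A → IsAlgebraicSet B →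
    C ⊆ A ∪ B → C ⊆ A ∨ C ⊆ B

/-- The ideal of all real polynomials that vanish on `C`. -/
noncomputable def idealOfSet (C : Set Space3) : Ideal (MvPolynomial (Fin 3) ℝ) :=
  MvPolynomial.vanishingIdeal ℝ ((fun x : Space3 => (⇑x : Fin 3 → ℝ)) '' C)

/-- An irreducible algebraic space curve: an irreducible real algebraic subset of three-space
of dimension one, the dimension being the Krull dimension of the coordinate ring. -/
structure IsIrreducibleAlgebraicCurve (C : Set Space3) : Prop where
  isAlgebraic : IsAlgebraicSet C
  isIrreducible : IsZariskiIrreducible C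
  dim_eq_one : ringKrullDim (MvPolynomial (Fin 3) ℝ ⧸ idealOfSet C) = 1

/-- A straight line. -/
def IsStraightLine (C : Set Space3) : Prop :=
  ∃ L : AffineSubspace ℝ Space3, (L : Set Space3).Nonempty ∧
    Module.finrank ℝ L.direction = 1 ∧ C = L

/-- A circle of positive radius, lying in a plane `P` through its center `c`. -/
def IsSpaceCircle (C : Set Space3) : Prop :=
  ∃ (P : AffineSubspace ℝ Space3) (c : Space3) (r : ℝ),
    Module.finrank ℝ P.direction = 2 ∧ c ∈ P ∧ 0 < r ∧ C = {x : Space3 | x ∈ P ∧ dist x c = r}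

/-- A similarity `x ↦ l Q x + b`, with signed ratio `l ≠ 0` and `Q` a rotation matrix. -/
def IsSimilarity (f : Space3 → Space3) : Prop :=
  ∃ (l : ℝ) (Q : Matrix (Fin 3) (Fin 3) ℝ) (b : Space3),
    l ≠ 0 ∧ Q.transpose * Q = 1 ∧ Q.det = 1 ∧ ∀ x : Space3, f x = l • Matrix.toEuclideanLin Q x + b

/-- `f` is a similarity that carries `C₁` onto `C₂`. -/
def IsSimilarityBetween (C₁ C₂ : Set Space3) (f : Space3 → Space3) : Prop :=
  IsSimilarity f ∧ f '' C₁ = C₂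

/-- Two sets are similar if some similarity carries the first onto the second. -/
def AreSimilar (C₁ C₂ : Set Space3) : Prop :=
  ∃ f : Space3 → Space3, IsSimilarityBetween C₁ C₂ f

/-- A set is symmetric if a nontrivial isometry of three-space leaves it invariant. -/
def IsSymmetric (C : Set Space3) : Prop :=
  ∃ g : Space3 ≃ᵃⁱ[ℝ] Space3, g ≠ AffineIsometryEquiv.refl ℝ Space3 ∧ g '' C = C

/-! Fix one similarity `f₀` between the curves. Composing with its inverse turns every other one
into a self-similarity of `C₁`, so it suffices that a curve which is neither a line nor a circle has
finitely many self-similarities, all of them isometries. In odd dimension a signed ratio with a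
rotation amounts to a positive ratio with an arbitrary orthogonal map (`isSimilarity_iff`).

A ratio greater than one, or a screw motion with nonzero translation part, drives the orbit of a
point of the curve to infinity along directions that recur. Any polynomial vanishing on the curve
then vanishes on whole lines (`IsAlgebraicSet.line_mem_of_recurrent`), and a curve containing a line
is that line. Hence self-similarities are isometries with a fixed point.

The square of such an isometry has an axis, so its orbits lie in the intersection of a plane and a
sphere. A Bezout-type bound D, uniform over planes and spheres, shows that an orbit on the curve
with more than D points forces the whole curve into that intersection, making it a circle. So the
orders are uniformly bounded (`exists_iterate_eq`). An orthogonal map of bounded order near the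
identity is the identity, so the linear parts are uniformly separated in a compact set, and there
are finitely many of them. -/

/-! ### Noether normalization and a Bezout-type bound. -/

open Polynomial in
/-- Noether normalization in dimension one: a finitely generated domain of Krull dimension one
is a finite extension of a polynomial ring in one variable. -/
theorem exists_finite_injective_polynomial_algHom (k A : Type*) [Field k] [CommRing A] [IsDomain A]
    [Algebra k A] [Algebra.FiniteType k A] (hdim : ringKrullDim A = 1) :
    ∃ g : k[X] →ₐ[k] A, Function.Injective g ∧ g.Finite := by
  obtain ⟨s, g, hinj, hfin⟩ := exists_finite_inj_algHom_of_fg k A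
  have hle : Ring.KrullDimLE 1 A := Ring.krullDimLE_iff.mpr hdim.le
  have hs : s = 1 := by
    algebraize [g.toRingHom]
    have : Module.Finite (MvPolynomial (Fin s) k) A := hfin
    have hint : Algebra.IsIntegral (MvPolynomial (Fin s) k) A :=
      Algebra.IsIntegral.of_finite _ _
    -- Dimension descends by lying over: a nonzero prime lifts to a nonzero, hence maximal, prime of
    -- `A`, whose contraction along an integral extension is maximal.
    have hB : Ring.KrullDimLE 1 (MvPolynomial (Fin s) k) := by
      refine Ring.KrullDimLE.mk₁' fun I hI hIp => ?_
      obtain ⟨J, hJp, hJ⟩ := Ideal.exists_ideal_over_prime_of_isIntegral_of_isDomain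
        (S := A) I (by
          rw [(RingHom.injective_iff_ker_eq_bot _).mp (show Function.Injective
            (algebraMap (MvPolynomial (Fin s) k) A) from hinj)]
          exact bot_le)
      have hJ0 : J ≠ ⊥ := by
        rintro rfl
        apply hI
        rw [← hJ]
        exact (RingHom.injective_iff_ker_eq_bot _).mp (show Function.Injective
            (algebraMap (MvPolynomial (Fin s) k) A) from hinj)
      have := hJp.isMaximal_of_ne_bot hJ0
      rw [← hJ]
      exact Ideal.isMaximal_comap_of_isIntegral_of_isMaximal J
    have h1 := Ring.krullDimLE_iff.mp hB
    rw [MvPolynomial.ringKrullDim_of_isNoetherianRing, ringKrullDim_eq_zero_of_field] at h1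
    have h2 : s ≤ 1 := by
      simpa using h1
    have h3 : s ≠ 0 := by
      rintro rfl
      have : IsField (MvPolynomial (Fin 0) k) :=
        MulEquiv.isField (Field.toIsField k) (MvPolynomial.isEmptyAlgEquiv k (Fin 0)).toMulEquiv
      have hA := isField_of_isIntegral_of_isField' (R := MvPolynomial (Fin 0) k) (S := A) this
      rw [ringKrullDim_eq_zero_of_isField hA] at hdim
      exact zero_ne_one hdim
    omega
  subst hs
  let e : k[X] ≃ₐ[k] MvPolynomial (Fin 1) k := (MvPolynomial.uniqueAlgEquiv k (Fin 1)).symm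
  refine ⟨g.comp e.toAlgHom, hinj.comp e.injective, ?_⟩
  exact AlgHom.Finite.comp hfin (AlgHom.Finite.of_surjective _ e.surjective)

/-- The determinant of a matrix of polynomials of degree at most `d` has degree at most `n * d`. -/
theorem Matrix.natDegree_det_le_of_natDegree_le {R n : Type*} [CommRing R] [Fintype n]
    [DecidableEq n] (M : Matrix n n (Polynomial R)) (d : ℕ) (h : ∀ i j, (M i j).natDegree ≤ d) :
    M.det.natDegree ≤ Fintype.card n * d := by
  rw [Matrix.det_apply]
  refine Polynomial.natDegree_sum_le_of_forall_le _ _ fun σ _ => ?_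
  refine (Polynomial.natDegree_smul_le _ _).trans ?_
  refine (Polynomial.natDegree_prod_le _ _).trans ?_
  refine (Finset.sum_le_card_nsmul _ _ d fun i _ => h _ _).trans ?_
  simp

open Polynomial in
/-- Bezout-type bound: on an affine curve, the nonzero members of a finite-dimensional space of
functions have a uniformly bounded number of zeros. -/
theorem exists_card_zeros_le {A κ : Type*} [CommRing A] [IsDomain A] [Algebra ℝ A]
    [Algebra.FiniteType ℝ A] (hdim : ringKrullDim A = 1) [Fintype κ] (s : κ → A) :
    ∃ D : ℕ, ∀ a : κ → ℝ, ∑ k, a k • s k ≠ 0 → ∀ T : Finset (A →ₐ[ℝ] ℝ),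
      (∀ φ ∈ T, φ (∑ k, a k • s k) = 0) → T.card ≤ D := by
  classical
  obtain ⟨g, hinj, hfin⟩ := exists_finite_injective_polynomial_algHom ℝ A hdim
  algebraize [g.toRingHom]
  have : Module.Finite ℝ[X] A := hfin
  have htower : IsScalarTower ℝ ℝ[X] A := IsScalarTower.of_algebraMap_eq fun r => by
    rw [RingHom.algebraMap_toAlgebra]
    exact (g.commutes r).symm
  have hinj' : Function.Injective (algebraMap ℝ[X] A) := hinj
  have : Module.IsTorsionFree ℝ[X] A := by
    rw [← faithfulSMul_iff_algebraMap_injective] at hinj'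
    infer_instance
  let b := Module.Free.chooseBasis ℝ[X] A
  let ι := Module.Free.ChooseBasisIndex ℝ[X] A
  let L : A →ₐ[ℝ[X]] Matrix ι ι ℝ[X] := Algebra.leftMulMatrix b
  -- A degree bound for the multiplication matrices of all `s k`; it also serves every real linear
  -- combination, so the final bound does not depend on `a`.
  let δ : ℕ := Finset.univ.sup fun k => Finset.univ.sup fun i : ι =>
    Finset.univ.sup fun j : ι => (L (s k) i j).natDegree
  obtain ⟨G, hG⟩ := (Algebra.FiniteType.out : (⊤ : Subalgebra ℝ A).FG)
  have hint : ∀ y : A, ∃ q : ℝ[X][X], q.Monic ∧ aeval y q = 0 := fun y =>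
    Algebra.IsIntegral.isIntegral (R := ℝ[X]) y
  choose q hqm hq using hint
  -- First factor: possible values of the coordinate `X` at a zero, which are roots of the norm of
  -- `f`. The product bounds the number of points with a given value of `X`.
  refine ⟨Fintype.card ι * δ * ∏ y ∈ G, (q y).natDegree, fun a hf T hT => ?_⟩
  set f := ∑ k, a k • s k with hfdef
  have hLf : ∀ i j, (L f i j).natDegree ≤ δ := by
    intro i j
    have : L f i j = ∑ k, a k • L (s k) i j := by
      rw [hfdef, map_sum, Matrix.sum_apply]
      refine Finset.sum_congr rfl fun k _ => ?_
      have : L (a k • s k) = a k • L (s k) := (L.toLinearMap.restrictScalars ℝ).map_smul _ _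
      rw [this, Matrix.smul_apply]
    rw [this]
    refine natDegree_sum_le_of_forall_le _ _ fun k _ => (natDegree_smul_le _ _).trans ?_
    exact (Finset.le_sup (f := fun j : ι => (L (s k) i j).natDegree) (Finset.mem_univ j)).trans <|
      (Finset.le_sup (f := fun i : ι => Finset.univ.sup
        fun j : ι => (L (s k) i j).natDegree) (Finset.mem_univ i)).trans <|
      Finset.le_sup (f := fun k => Finset.univ.sup fun i : ι =>
        Finset.univ.sup fun j : ι => (L (s k) i j).natDegree) (Finset.mem_univ k)
  set Δ : ℝ[X] := (L f).det with hΔ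
  have hΔdeg : Δ.natDegree ≤ Fintype.card ι * δ :=
    Matrix.natDegree_det_le_of_natDegree_le _ _ hLf
  have hΔ0 : Δ ≠ 0 := by
    have : Δ = Algebra.norm ℝ[X] f := (Algebra.norm_eq_matrix_det b f).symm
    rw [this]
    exact (Algebra.norm_ne_zero_iff).mpr hf
  let τ : (A →ₐ[ℝ] ℝ) → ℝ := fun φ => φ (algebraMap ℝ[X] A X)
  have hτ : ∀ (φ : A →ₐ[ℝ] ℝ) (p : ℝ[X]), φ (algebraMap ℝ[X] A p) = p.eval (τ φ) := by
    intro φ p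
    have h : (φ.comp g) = aeval (τ φ) := by
      ext
      simp [τ]
      rfl
    have := DFunLike.congr_fun h p
    rw [← coe_aeval_eq_eval]
    exact this
  have hroot : ∀ φ ∈ T, τ φ ∈ Δ.roots.toFinset := by
    intro φ hφ
    rw [Multiset.mem_toFinset, mem_roots hΔ0, IsRoot.def]
    rw [hΔ, ← coe_evalRingHom, RingHom.map_det]
    -- The values of the basis at a zero of `f` form a left null vector of the multiplication matrix
    -- specialized at `τ φ`; it is nonzero because `φ 1 = 1`.
    have hv : (fun j => φ (b j)) ≠ 0 := by
      intro h0
      have h1 : φ 1 = 0 := by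
        rw [← b.sum_repr (1 : A), map_sum]
        refine Finset.sum_eq_zero fun j _ => ?_
        rw [Algebra.smul_def, map_mul, show φ (b j) = 0 from congrFun h0 j, mul_zero]
      simp at h1
    refine Matrix.exists_vecMul_eq_zero_iff.mp ⟨_, hv, ?_⟩
    ext j
    have h2 : f * b j = ∑ i, L f i j • b i := by
      rw [← b.sum_repr (f * b j)]
      refine Finset.sum_congr rfl fun i _ => ?_
      rw [Algebra.leftMulMatrix_eq_repr_mul]
    have h3 := congrArg φ h2
    rw [map_mul, hT φ hφ, zero_mul, map_sum] at h3
    simp only [Matrix.vecMul, dotProduct, RingHom.mapMatrix_apply, Matrix.map_apply,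
      coe_evalRingHom, Pi.zero_apply]
    rw [h3]
    refine Finset.sum_congr rfl fun i _ => ?_
    rw [Algebra.smul_def, map_mul, hτ, mul_comm]
  have hfib : ∀ r ∈ T.image τ, (T.filter fun φ => τ φ = r).card ≤ ∏ y ∈ G, (q y).natDegree := by
    intro r _
    -- On the fibre over `r`, each generator takes a value among the roots of its specialized
    -- integral equation, and these values determine the point.
    let Q : A → Finset ℝ := fun y => ((q y).map (evalRingHom r)).roots.toFinset
    have hcard : (G.pi Q).card ≤ ∏ y ∈ G, (q y).natDegree := by
      rw [Finset.card_pi]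
      refine Finset.prod_le_prod' fun y _ => ?_
      refine (Multiset.toFinset_card_le _).trans ((card_roots' _).trans ?_)
      exact natDegree_map_le
    refine le_trans (Finset.card_le_card_of_injOn (fun φ y _ => φ y) ?_ ?_) hcard
    · intro φ hφ
      rw [Finset.mem_coe, Finset.mem_filter] at hφ
      rw [Finset.mem_coe, Finset.mem_pi]
      intro y _
      rw [Multiset.mem_toFinset, mem_roots ((hqm y).map _).ne_zero, IsRoot.def, eval_map]
      have h := congrArg φ (hq y)
      rw [map_zero, aeval_def, ← AlgHom.coe_toRingHom, hom_eval₂] at h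
      rw [← h]
      congr 1
      ext p
      · simp
      · simp [hτ, hφ.2]
    · intro φ _ ψ _ h
      have : Set.EqOn φ ψ (G : Set A) := fun y hy => congrFun (congrFun h y) hy
      exact AlgHom.ext_of_adjoin_eq_top hG this
  calc T.card ≤ (∏ y ∈ G, (q y).natDegree) * (T.image τ).card :=
        Finset.card_le_mul_card_image T _ hfib
    _ ≤ (∏ y ∈ G, (q y).natDegree) * (Fintype.card ι * δ) := by
        refine Nat.mul_le_mul_left _ ?_
        calc (T.image τ).card ≤ Δ.roots.toFinset.card := Finset.card_le_card fun r hr => by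
              obtain ⟨φ, hφ, rfl⟩ := Finset.mem_image.mp hr
              exact hroot φ hφ
          _ ≤ Δ.natDegree := (Multiset.toFinset_card_le _).trans (card_roots' _)
          _ ≤ _ := hΔdeg
    _ = _ := mul_comm _ _

/-! ### Vanishing ideals, irreducibility and curves. -/

theorem mem_idealOfSet {C : Set Space3} {p : MvPolynomial (Fin 3) ℝ} :
    p ∈ idealOfSet C ↔ ∀ x ∈ C, MvPolynomial.eval (⇑x) p = 0 := by
  simp [idealOfSet, MvPolynomial.mem_vanishingIdeal_iff, MvPolynomial.aeval_eq_eval]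

theorem idealOfSet_mono {A B : Set Space3} (h : A ⊆ B) : idealOfSet B ≤ idealOfSet A :=
  fun _ hp => mem_idealOfSet.mpr fun x hx => mem_idealOfSet.mp hp x (h hx)

theorem isAlgebraicSet_zeroLocus (p : MvPolynomial (Fin 3) ℝ) :
    IsAlgebraicSet {x : Space3 | MvPolynomial.eval (⇑x) p = 0} :=
  ⟨{p}, by simp⟩

theorem IsAlgebraicSet.mem_iff {C : Set Space3} (hC : IsAlgebraicSet C) (x : Space3) :
    x ∈ C ↔ ∀ p ∈ idealOfSet C, MvPolynomial.eval (⇑x) p = 0 := by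
  refine ⟨fun hx p hp => mem_idealOfSet.mp hp x hx, fun h => ?_⟩
  obtain ⟨S, rfl⟩ := hC
  exact fun p hp => h p (mem_idealOfSet.mpr fun y hy => hy p hp)

theorem isAlgebraicSet_empty : IsAlgebraicSet ∅ := ⟨{1}, by simp⟩

theorem isAlgebraicSet_singleton (a : Space3) : IsAlgebraicSet {a} := by
  refine ⟨Set.range fun i => MvPolynomial.X i - MvPolynomial.C (a i), ?_⟩
  ext x
  simp only [Set.mem_singleton_iff, Set.mem_range, forall_exists_index,
    forall_apply_eq_imp_iff, map_sub, MvPolynomial.eval_X, MvPolynomial.eval_C, sub_eq_zero,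
    Set.mem_ofPred_eq]
  exact ⟨fun h i => h ▸ rfl, fun h => by ext i; exact h i⟩

theorem isPrime_idealOfSet {C : Set Space3} (hC : IsZariskiIrreducible C) :
    (idealOfSet C).IsPrime := by
  refine ⟨fun h => ?_, fun {p q} hpq => ?_⟩
  · obtain ⟨x, hx⟩ := hC.1
    have h1 : (1 : MvPolynomial (Fin 3) ℝ) ∈ idealOfSet C := h ▸ Submodule.mem_top
    simpa using mem_idealOfSet.mp h1 x hx
  · rcases hC.2 _ _ (isAlgebraicSet_zeroLocus p) (isAlgebraicSet_zeroLocus q)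
      (fun x hx => by simpa using mem_idealOfSet.mp hpq x hx) with h | h
    · exact Or.inl (mem_idealOfSet.mpr h)
    · exact Or.inr (mem_idealOfSet.mpr h)

theorem idealOfSet_singleton_isMaximal (x : Space3) : (idealOfSet {x}).IsMaximal := by
  rw [idealOfSet, Set.image_singleton]
  infer_instance

theorem idealOfSet_singleton_injective :
    Function.Injective fun x : Space3 => idealOfSet {x} := by
  intro x y h
  have hx := (isAlgebraicSet_singleton y).mem_iff x
  have h' : idealOfSet {x} = idealOfSet {y} := h
  rw [← h'] at hx
  exact hx.mpr fun p hp => mem_idealOfSet.mp hp x rfl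

/-- Finite sets are algebraic, so irreducibility lets the points of a finite cover be split off one
at a time. -/
theorem IsZariskiIrreducible.exists_eq_singleton {C : Set Space3} (hC : IsZariskiIrreducible C)
    (hfin : C.Finite) : ∃ x, C = {x} := by
  have key : ∀ s : Set Space3, s.Finite → IsAlgebraicSet s ∧ (C ⊆ s → ∃ x, C ⊆ {x}) := by
    intro s hs
    induction s, hs using Set.Finite.induction_on with
    | empty =>
      refine ⟨isAlgebraicSet_empty, fun h => ?_⟩
      obtain ⟨x, hx⟩ := hC.1
      exact (h hx).elim
    | @insert a s _ _ ih =>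
      refine ⟨?_, fun h => ?_⟩
      · obtain ⟨S, hS⟩ := ih.1
        obtain ⟨T, hT⟩ := isAlgebraicSet_singleton a
        refine ⟨Set.image2 (· * ·) T S, ?_⟩
        rw [Set.insert_eq, hS, hT]
        ext x
        simp only [Set.mem_union, Set.mem_ofPred_eq, Set.mem_image2, forall_exists_index, and_imp]
        constructor
        · rintro (h | h) _ p hp q hq rfl
          · simp [h p hp]
          · simp [h q hq]
        · intro h
          by_contra! hcon
          obtain ⟨⟨p, hp, hp'⟩, q, hq, hq'⟩ := hcon
          have := h _ p hp q hq rfl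
          rw [map_mul] at this
          exact (mul_ne_zero hp' hq') this
      · rcases hC.2 _ _ (isAlgebraicSet_singleton a) ih.1 (by rwa [← Set.insert_eq]) with h | h
        · exact ⟨a, h⟩
        · exact ih.2 h
  obtain ⟨x, hx⟩ := (key C hfin).2 le_rfl
  exact ⟨x, (Set.Nonempty.subset_singleton_iff hC.1).mp hx⟩

/-- The functions `α‖x‖² + ⟪v, x⟫ + β` are polynomial. -/
theorem exists_eval_eq_quadric (α : ℝ) (v : Space3) (β : ℝ) :
    ∃ p : MvPolynomial (Fin 3) ℝ, ∀ x : Space3,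
      MvPolynomial.eval (⇑x) p = α * ‖x‖ ^ 2 + inner ℝ v x + β := by
  refine ⟨∑ i, MvPolynomial.C (v i) * MvPolynomial.X i +
    (MvPolynomial.C α * ∑ i, MvPolynomial.X i ^ 2 + MvPolynomial.C β), fun x => ?_⟩
  simp only [map_add, map_sum, map_mul, MvPolynomial.eval_C, EuclideanSpace.real_norm_sq_eq,
    PiLp.inner_apply, MvPolynomial.eval_X, map_pow]
  simp only [RCLike.inner_apply, conj_trivial, mul_comm]
  ring

namespace IsIrreducibleAlgebraicCurve

variable {C : Set Space3}

theorem infinite (hC : IsIrreducibleAlgebraicCurve C) : C.Infinite := by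
  intro hfin
  obtain ⟨x, rfl⟩ := hC.isIrreducible.exists_eq_singleton hfin
  have := idealOfSet_singleton_isMaximal x
  have h := hC.dim_eq_one
  rw [ringKrullDim_eq_zero_of_isField ((Ideal.Quotient.maximal_ideal_iff_isField_quotient _).mp
    this)] at h
  exact zero_ne_one h

/-- A curve has no proper infinite algebraic subset. -/
theorem eq_of_infinite_subset (hC : IsIrreducibleAlgebraicCurve C) {A : Set Space3}
    (hA : IsAlgebraicSet A) (hinf : A.Infinite) (hAC : A ⊆ C) : A = C := by
  have hp := isPrime_idealOfSet hC.isIrreducible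
  have hle : Ring.KrullDimLE 1 (MvPolynomial (Fin 3) ℝ ⧸ idealOfSet C) :=
    Ring.krullDimLE_iff.mpr hC.dim_eq_one.le
  refine hAC.antisymm ?_
  by_contra hnot
  have hne : ∃ p ∈ idealOfSet A, p ∉ idealOfSet C := by
    by_contra! hcon
    exact hnot fun x hx => (hA.mem_iff x).mpr fun p hp => mem_idealOfSet.mp (hcon p hp) x hx
  obtain ⟨p, hpA, hpC⟩ := hne
  -- Points of `A` give minimal primes over its ideal, of which a Noetherian ring has finitely many.
  -- Minimality: a prime between that ideal and the ideal of a point contains `p`, so it is nonzero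
  -- modulo the ideal of `C` and hence already maximal.
  refine hinf (Set.Finite.of_finite_image (f := fun x : Space3 => idealOfSet {x})
    ((idealOfSet A).finite_minimalPrimes_of_isNoetherianRing.subset ?_)
    idealOfSet_singleton_injective.injOn)
  rintro _ ⟨x, hx, rfl⟩
  refine ⟨⟨(idealOfSet_singleton_isMaximal x).isPrime,
    idealOfSet_mono (Set.singleton_subset_iff.mpr hx)⟩, ?_⟩
  rintro P ⟨hP, hAP⟩ hPx
  have hCP : idealOfSet C ≤ P := (idealOfSet_mono hAC).trans hAP
  have hmax : (P.map (Ideal.Quotient.mk (idealOfSet C))).IsMaximal := by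
    refine Ideal.IsPrime.isMaximal_of_ne_bot
      (Ideal.map_isPrime_of_surjective Ideal.Quotient.mk_surjective (by rwa [Ideal.mk_ker])) ?_
    intro h0
    have : Ideal.Quotient.mk (idealOfSet C) p ∈ P.map (Ideal.Quotient.mk (idealOfSet C)) :=
      Ideal.mem_map_of_mem _ (hAP hpA)
    rw [h0, Ideal.mem_bot, Ideal.Quotient.eq_zero_iff_mem] at this
    exact hpC this
  have hPmax : P.IsMaximal := by
    have h := Ideal.comap_isMaximal_of_surjective (Ideal.Quotient.mk (idealOfSet C))
      Ideal.Quotient.mk_surjective (H := hmax)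
    rwa [Ideal.comap_map_of_surjective _ Ideal.Quotient.mk_surjective, ← RingHom.ker_eq_comap_bot,
      Ideal.mk_ker, sup_eq_left.mpr hCP] at h
  exact (hPmax.eq_of_le (idealOfSet_singleton_isMaximal x).ne_top hPx).ge

/-- The functions `α‖x‖² + ⟪v, x⟫ + β` that do not vanish identically on a curve have a uniformly
bounded number of zeros there. -/
theorem exists_card_quadric_inter_le (hC : IsIrreducibleAlgebraicCurve C) :
    ∃ D : ℕ, ∀ (α : ℝ) (v : Space3) (β : ℝ) (T : Finset Space3), (T : Set Space3) ⊆ C →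
      (∀ x ∈ T, α * ‖x‖ ^ 2 + inner ℝ v x + β = 0) → D < T.card →
      ∀ x ∈ C, α * ‖x‖ ^ 2 + inner ℝ v x + β = 0 := by
  classical
  have hp := isPrime_idealOfSet hC.isIrreducible
  let mk := Ideal.Quotient.mkₐ ℝ (idealOfSet C)
  let S : Fin 3 ⊕ Fin 2 → MvPolynomial (Fin 3) ℝ :=
    Sum.elim MvPolynomial.X ![∑ i, MvPolynomial.X i ^ 2, 1]
  obtain ⟨D, hD⟩ := exists_card_zeros_le hC.dim_eq_one (fun k => mk (S k))
  refine ⟨D, fun α v β T hTC hT hcard => ?_⟩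
  let a : Fin 3 ⊕ Fin 2 → ℝ := Sum.elim v ![α, β]
  let P : MvPolynomial (Fin 3) ℝ := ∑ k, a k • S k
  have hP : ∀ x : Space3, MvPolynomial.eval (⇑x) P = α * ‖x‖ ^ 2 + inner ℝ v x + β := by
    intro x
    simp only [P, a, S, Fintype.sum_sum_type, Sum.elim_inl, Sum.elim_inr, Fin.sum_univ_two,
      map_add, map_sum, MvPolynomial.smul_eval, Matrix.cons_val_zero, Matrix.cons_val_one,
      EuclideanSpace.real_norm_sq_eq, PiLp.inner_apply, MvPolynomial.eval_X, map_pow, map_one]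
    simp only [RCLike.inner_apply, conj_trivial, mul_comm]
    ring
  have hmkP : ∑ k, a k • mk (S k) = mk P := by simp [P, map_sum]
  have hex : ∀ x ∈ C, ∃ φ : (MvPolynomial (Fin 3) ℝ ⧸ idealOfSet C) →ₐ[ℝ] ℝ,
      ∀ p, φ (mk p) = MvPolynomial.eval (⇑x) p := fun x hx =>
    ⟨Ideal.Quotient.liftₐ (idealOfSet C) (MvPolynomial.aeval (⇑x))
      (fun p hp => by rw [MvPolynomial.aeval_eq_eval]; exact mem_idealOfSet.mp hp x hx),
      fun p => congrFun (MvPolynomial.aeval_eq_eval (⇑x)) p⟩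
  obtain ⟨x₀, hx₀⟩ := hC.isIrreducible.1
  have : Nonempty ((MvPolynomial (Fin 3) ℝ ⧸ idealOfSet C) →ₐ[ℝ] ℝ) :=
    ⟨(hex x₀ hx₀).choose⟩
  choose! ev hev using hex
  have hinj : Set.InjOn ev T := by
    intro x hx y hy hxy
    ext i
    have := hev x (hTC hx) (MvPolynomial.X i)
    rw [hxy, hev y (hTC hy)] at this
    simpa using this.symm
  have h0 : mk P = 0 := by
    by_contra hne
    have := hD a (by rwa [hmkP]) (T.image ev) (by
      intro φ hφ
      obtain ⟨x, hx, rfl⟩ := Finset.mem_image.mp hφ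
      rw [hmkP, hev x (hTC hx), hP, hT x hx])
    rw [Finset.card_image_of_injOn hinj] at this
    omega
  intro x hx
  rw [← hP, ← hev x hx, h0, map_zero]

end IsIrreducibleAlgebraicCurve

/-! ### Recognizing lines and circles. -/

open Filter Topology

theorem isStraightLine_of_mem_iff {C : Set Space3} {x₀ v : Space3} (hv : v ≠ 0)
    (h : ∀ x, x ∈ C ↔ ∃ s : ℝ, x = x₀ + s • v) : IsStraightLine C := by
  refine ⟨AffineSubspace.mk' x₀ (Submodule.span ℝ {v}), ⟨x₀, AffineSubspace.self_mem_mk' _ _⟩, ?_,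
    ?_⟩
  · rw [AffineSubspace.direction_mk', finrank_span_singleton hv]
  · ext x
    rw [h, SetLike.mem_coe, AffineSubspace.mem_mk', Submodule.mem_span_singleton, vsub_eq_sub]
    refine exists_congr fun s => ⟨fun h => ?_, fun h => ?_⟩
    · rw [h]; abel
    · rw [h]; abel

/-- The restriction of a polynomial to a parametrized line is a polynomial. -/
theorem exists_eval_line_eq (p : MvPolynomial (Fin 3) ℝ) (u w : Space3) :
    ∃ q : Polynomial ℝ, ∀ s : ℝ, q.eval s = MvPolynomial.eval (⇑(u + s • w)) p := by
  refine ⟨MvPolynomial.aeval (fun i => Polynomial.C (u i) + Polynomial.X * Polynomial.C (w i)) p,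
    fun s => ?_⟩
  rw [← Polynomial.coe_evalRingHom, MvPolynomial.aeval_def, MvPolynomial.hom_eval₂,
    MvPolynomial.eval, MvPolynomial.coe_eval₂Hom]
  congr 1
  · ext; simp
  · ext i
    simp only [Polynomial.coe_evalRingHom, Polynomial.eval_add, Polynomial.eval_C,
      Polynomial.eval_mul, Polynomial.eval_X, PiLp.add_apply, PiLp.smul_apply, smul_eq_mul]

theorem isAlgebraicSet_line (x₀ v : Space3) :
    IsAlgebraicSet {x | ∃ s : ℝ, x = x₀ + s • v} := by
  choose P hP using exists_eval_eq_quadric 0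
  refine ⟨{p | ∃ w : Space3, inner ℝ w v = 0 ∧ p = P w (-inner ℝ w x₀)}, ?_⟩
  ext x
  simp only [Set.mem_ofPred_eq, forall_exists_index, and_imp]
  constructor
  · rintro ⟨s, rfl⟩ _ w hw rfl
    rw [hP, inner_add_right, inner_smul_right, hw]
    ring
  · intro h
    have hmem : x - x₀ ∈ (Submodule.span ℝ {v})ᗮᗮ := by
      rw [Submodule.mem_orthogonal]
      intro w hw
      have h1 := h _ w ((Submodule.mem_orthogonal' _ _).mp hw v (Submodule.mem_span_singleton_self v))
        rfl
      rw [hP] at h1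
      rw [inner_sub_right]
      linarith
    rw [Submodule.orthogonal_orthogonal, Submodule.mem_span_singleton] at hmem
    obtain ⟨s, hs⟩ := hmem
    exact ⟨s, by rw [hs]; abel⟩

theorem infinite_line (x₀ : Space3) {v : Space3} (hv : v ≠ 0) :
    {x | ∃ s : ℝ, x = x₀ + s • v}.Infinite := by
  have : Function.Injective fun s : ℝ => x₀ + s • v :=
    (add_right_injective x₀).comp (smul_left_injective ℝ hv)
  refine (Set.infinite_range_of_injective this).mono ?_
  rintro _ ⟨s, rfl⟩
  exact ⟨s, rfl⟩

namespace IsIrreducibleAlgebraicCurve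

variable {C : Set Space3}

theorem isStraightLine_of_line_subset (hC : IsIrreducibleAlgebraicCurve C) {x₀ v : Space3}
    (hv : v ≠ 0) (h : ∀ s : ℝ, x₀ + s • v ∈ C) : IsStraightLine C := by
  have := hC.eq_of_infinite_subset (isAlgebraicSet_line x₀ v) (infinite_line x₀ hv) (by
    rintro _ ⟨s, rfl⟩
    exact h s)
  refine isStraightLine_of_mem_iff (x₀ := x₀) hv fun x => ?_
  rw [← this]
  rfl

/-- A polynomial vanishing on `C` restricts to the line as a one-variable polynomial with infinitely
many roots, hence zero; so the whole line lies in `C`. -/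
theorem isStraightLine_of_subset_line (hC : IsIrreducibleAlgebraicCurve C) {x₀ v : Space3}
    (hv : v ≠ 0) (h : ∀ x ∈ C, ∃ s : ℝ, x = x₀ + s • v) : IsStraightLine C := by
  refine hC.isStraightLine_of_line_subset (x₀ := x₀) hv fun s => ?_
  rw [hC.isAlgebraic.mem_iff]
  intro p hp
  obtain ⟨q, hq⟩ := exists_eval_line_eq p x₀ v
  have hinf : {s : ℝ | q.IsRoot s}.Infinite := by
    refine Set.Infinite.mono (s := (fun s : ℝ => x₀ + s • v) ⁻¹' C) ?_
      (hC.infinite.preimage ?_)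
    · intro s hs
      change q.eval s = 0
      rw [hq]
      exact mem_idealOfSet.mp hp _ hs
    · intro x hx
      obtain ⟨s, rfl⟩ := h x hx
      exact ⟨s, rfl⟩
  rw [← hq, Polynomial.eq_zero_of_infinite_isRoot q hinf, Polynomial.eval_zero]

/-- A curve contained in the intersection of a plane and a sphere is a circle. -/
theorem isSpaceCircle_of_subset (hC : IsIrreducibleAlgebraicCurve C) {u c : Space3} {β ρ : ℝ}
    (hu : u ≠ 0) (hplane : ∀ x ∈ C, inner ℝ u x = β) (hsphere : ∀ x ∈ C, ‖x - c‖ ^ 2 = ρ) :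
    IsSpaceCircle C := by
  have huu : inner ℝ u u ≠ (0 : ℝ) := by simpa using hu
  -- Chosen so that `c'` is the orthogonal projection of `c` to the plane, the center of the circle.
  set κ : ℝ := (β - inner ℝ u c) / inner ℝ u u with hκ
  set c' : Space3 := c + κ • u with hc'
  have hκu : κ * inner ℝ u u = β - inner ℝ u c := by rw [hκ]; field_simp
  have horth : ∀ x ∈ C, inner ℝ u (x - c') = (0 : ℝ) := by
    intro x hx
    rw [hc', inner_sub_right, inner_add_right, inner_smul_right, hplane x hx, hκu]
    ring
  have hnorm : ∀ x ∈ C, ‖x - c'‖ ^ 2 = ρ - κ ^ 2 * ‖u‖ ^ 2 := by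
    intro x hx
    have h1 : x - c = (x - c') + κ • u := by rw [hc']; abel
    have h2 := hsphere x hx
    rw [h1, norm_add_sq_real, inner_smul_right, real_inner_comm, horth x hx, norm_smul, mul_pow,
      Real.norm_eq_abs, sq_abs] at h2
    linarith
  obtain ⟨x₀, hx₀⟩ := hC.isIrreducible.1
  set r := ‖x₀ - c'‖ with hr
  have hdist : ∀ x ∈ C, ‖x - c'‖ = r := by
    intro x hx
    have : ‖x - c'‖ ^ 2 = r ^ 2 := by rw [hr, hnorm x hx, hnorm x₀ hx₀]
    exact (pow_left_inj₀ (norm_nonneg _) (norm_nonneg _) two_ne_zero).mp this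
  have hr0 : 0 < r := by
    refine lt_of_le_of_ne (norm_nonneg _) fun h0 => hC.infinite ?_
    refine (Set.finite_singleton c').subset fun x hx => ?_
    have := hdist x hx
    rw [← h0, norm_eq_zero, sub_eq_zero] at this
    exact this
  set W := (Submodule.span ℝ {u})ᗮ with hW
  have hWfin : Module.finrank ℝ W = 2 := by
    have h1 := Submodule.finrank_add_finrank_orthogonal (Submodule.span ℝ {u})
    rw [finrank_span_singleton hu, finrank_euclideanSpace_fin] at h1
    rw [hW]
    omega
  have hmemW : ∀ y, y ∈ W ↔ inner ℝ u y = (0 : ℝ) := fun y => by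
    rw [hW, Submodule.mem_orthogonal_singleton_iff_inner_right]
  let e : OrthonormalBasis (Fin 2) ℝ W :=
    (stdOrthonormalBasis ℝ W).reindex (finCongr hWfin)
  let γ : ℝ → Space3 := fun θ =>
    c' + ((r * Real.cos θ) • (e 0 : Space3) + (r * Real.sin θ) • (e 1 : Space3))
  have hγ : ∀ x, inner ℝ u (x - c') = (0 : ℝ) → ‖x - c'‖ = r →
      ∃ θ ∈ Set.Icc (-Real.pi) Real.pi, γ θ = x := by
    intro x hx1 hx2
    let y : W := ⟨x - c', (hmemW _).mpr hx1⟩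
    have hy : y = inner ℝ (e 0) y • e 0 + inner ℝ (e 1) y • e 1 := by
      conv_lhs => rw [← e.sum_repr' y, Fin.sum_univ_two]
    set a : ℝ := inner ℝ (e 0) y
    set b : ℝ := inner ℝ (e 1) y
    have hab : a ^ 2 + b ^ 2 = r ^ 2 := by
      have h1 := e.sum_sq_norm_inner_right y
      rw [Fin.sum_univ_two] at h1
      simp only [Real.norm_eq_abs, sq_abs] at h1
      have h2 : ‖y‖ = r := hx2
      rw [h2] at h1
      exact h1
    let z : ℂ := ⟨a, b⟩
    have hz : ‖z‖ = r := by
      have : ‖z‖ ^ 2 = r ^ 2 := by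
        rw [← Complex.normSq_eq_norm_sq, Complex.normSq_apply, ← hab]
        ring
      exact (pow_left_inj₀ (norm_nonneg _) hr0.le two_ne_zero).mp this
    have hz0 : z ≠ 0 := by
      rw [← norm_pos_iff, hz]
      exact hr0
    refine ⟨z.arg, ⟨(Complex.neg_pi_lt_arg z).le, Complex.arg_le_pi z⟩, ?_⟩
    have h1 : r * Real.cos z.arg = a := by
      rw [Complex.cos_arg hz0, hz]
      field_simp
      rfl
    have h2 : r * Real.sin z.arg = b := by
      rw [Complex.sin_arg, hz]
      field_simp
      rfl
    change c' + _ = x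
    rw [h1, h2]
    have h3 : (x - c' : Space3) = a • (e 0 : Space3) + b • (e 1 : Space3) := congrArg Subtype.val hy
    rw [← h3]
    abel
  -- Infinitely many parameters in a compact interval accumulate, so the identity theorem for
  -- analytic functions makes every polynomial of the ideal vanish on the full circle.
  have hinf : (Set.Icc (-Real.pi) Real.pi ∩ γ ⁻¹' C).Infinite := by
    refine Set.Infinite.of_image γ (hC.infinite.mono fun x hx => ?_)
    obtain ⟨θ, hθ, rfl⟩ := hγ x (horth x hx) (hdist x hx)
    exact ⟨θ, ⟨hθ, hx⟩, rfl⟩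
  obtain ⟨θ₀, -, hacc⟩ := hinf.exists_accPt_of_subset_isCompact isCompact_Icc Set.inter_subset_left
  have hall : ∀ θ, γ θ ∈ C := by
    intro θ
    rw [hC.isAlgebraic.mem_iff]
    intro p hp
    have hana : AnalyticOnNhd ℝ (fun θ => MvPolynomial.aeval (⇑(γ θ)) p) Set.univ := by
      refine AnalyticOnNhd.aeval_mvPolynomial (fun i θ _ => ?_) p
      have : (fun θ => (γ θ) i) = fun θ => c' i +
          ((r * Real.cos θ) * (e 0 : Space3) i + (r * Real.sin θ) * (e 1 : Space3) i) := by
        ext θ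
        simp [γ]
      rw [this]
      have hcos : AnalyticAt ℝ Real.cos θ := Real.analyticAt_cos
      have hsin : AnalyticAt ℝ Real.sin θ := Real.analyticAt_sin
      fun_prop
    have hz := hana.eqOn_zero_of_preconnected_of_frequently_eq_zero isPreconnected_univ
      (Set.mem_univ θ₀) (by
        refine (accPt_iff_frequently_nhdsNE.mp hacc).mono fun t ht => ?_
        rw [MvPolynomial.aeval_eq_eval]
        exact mem_idealOfSet.mp hp _ ht.2)
    have := hz (Set.mem_univ θ)
    simpa only [MvPolynomial.aeval_eq_eval, Pi.zero_apply] using this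
  refine ⟨AffineSubspace.mk' c' W, c', r, ?_, AffineSubspace.self_mem_mk' _ _, hr0, ?_⟩
  · rw [AffineSubspace.direction_mk', hWfin]
  · ext x
    rw [Set.mem_ofPred_eq, AffineSubspace.mem_mk', vsub_eq_sub, hmemW, dist_eq_norm]
    refine ⟨fun hx => ⟨horth x hx, hdist x hx⟩, fun ⟨h1, h2⟩ => ?_⟩
    obtain ⟨θ, -, rfl⟩ := hγ x h1 h2
    exact hall θ

end IsIrreducibleAlgebraicCurve

/-! ### Recurrence and lines inside algebraic sets. -/

/-- A bounded orbit of an isometry of a proper space is recurrent. -/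
theorem Isometry.mapClusterPt_iterate {X : Type*} [MetricSpace X] [ProperSpace X] {P : X → X}
    (hP : Isometry P) {x : X} (hb : Bornology.IsBounded (Set.range fun n => P^[n] x)) (m : ℕ) :
    MapClusterPt (P^[m] x) atTop fun n => P^[n] x := by
  have hiso : ∀ n, Isometry P^[n] := fun n => by
    induction n with
    | zero => exact isometry_id
    | succ n ih => exact ih.comp hP
  obtain ⟨z, -, φ, hφ, hlim⟩ := tendsto_subseq_of_bounded hb fun n => Set.mem_range_self n
  have hbase : MapClusterPt x atTop fun n => P^[n] x := by
    rw [mapClusterPt_iff_frequently]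
    intro s hs
    obtain ⟨ε, hε, hεs⟩ := Metric.mem_nhds_iff.mp hs
    rw [frequently_atTop]
    intro N
    obtain ⟨K, hK⟩ := Metric.cauchySeq_iff.mp hlim.cauchySeq ε hε
    have hKN : φ K + N ≤ φ (K + N) := by
      rw [add_comm K, add_comm _ N]
      exact hφ.add_le_nat N K
    -- Two nearby orbit points give a near return to `x` after cancelling the common isometric
    -- iterate; the shift by `N` makes the return time at least `N`.
    refine ⟨φ (K + N) - φ K, by omega, hεs ?_⟩
    rw [Metric.mem_ball, ← (hiso (φ K)).dist_eq, ← Function.iterate_add_apply,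
      show φ K + (φ (K + N) - φ K) = φ (K + N) by omega]
    exact hK (K + N) (by omega) K le_rfl
  have h2 := hbase.continuousAt_comp (hiso m).continuous.continuousAt
  refine MapClusterPt.of_comp (tendsto_add_atTop_nat m) (p := atTop) ?_
  convert h2 using 1
  funext n
  simp only [Function.comp_apply]
  rw [add_comm, Function.iterate_add_apply]

open Polynomial in
/-- If the polynomials `Φ (Y n)` vanish at `a n → ∞`, with `Φ` continuous and `Y` bounded and
recurrent, then they are zero. -/
theorem polynomial_eq_zero_of_recurrent {Z : Type*} [TopologicalSpace Z] {Φ : Z → ℝ[X]}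
    (hΦ : ∀ j, Continuous fun z => (Φ z).coeff j) {Y : ℕ → Z} {K : Set Z} (hK : IsCompact K)
    (hYK : ∀ n, Y n ∈ K) (hrec : ∀ m, MapClusterPt (Y m) atTop Y) {a : ℕ → ℝ}
    (ha : Tendsto a atTop atTop) (hroot : ∀ n, (Φ (Y n)).eval (a n) = 0) (d : ℕ)
    (hdeg : ∀ m, ∀ j ≥ d, (Φ (Y m)).coeff j = 0) (m : ℕ) : Φ (Y m) = 0 := by
  induction d with
  | zero =>
    ext j
    rw [hdeg m j (Nat.zero_le j), coeff_zero]
  | succ d ih =>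
    refine ih fun m j hj => ?_
    rcases Nat.lt_or_eq_of_le hj with hj | rfl
    · exact hdeg m j hj
    -- Dividing the equation by `a n ^ d` shows that the top coefficient tends to zero along the
    -- sequence; by recurrence each of its values is a cluster point, so each is zero.
    have hform : (fun n => (Φ (Y n)).coeff d) =ᶠ[atTop]
        fun n => -∑ j ∈ Finset.range d, (Φ (Y n)).coeff j * (a n ^ j / a n ^ d) := by
      filter_upwards [ha.eventually_gt_atTop 0] with n hn
      have h1 := hroot n
      have hdeg' : (Φ (Y n)).natDegree < d + 1 := by
        exact Nat.lt_succ_of_le (natDegree_le_iff_coeff_eq_zero.mpr fun j hj => hdeg n j hj)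
      rw [eval_eq_sum_range' hdeg', Finset.sum_range_succ] at h1
      have hpow : a n ^ d ≠ 0 := (pow_pos hn d).ne'
      have h2 : ∑ j ∈ Finset.range d, (Φ (Y n)).coeff j * (a n ^ j / a n ^ d) =
          (∑ j ∈ Finset.range d, (Φ (Y n)).coeff j * a n ^ j) / a n ^ d := by
        rw [Finset.sum_div]
        exact Finset.sum_congr rfl fun j _ => by ring
      rw [h2, eq_neg_iff_add_eq_zero]
      field_simp
      linarith
    have hlim : Tendsto (fun n => (Φ (Y n)).coeff d) atTop (𝓝 0) := by
      rw [tendsto_congr' hform, ← neg_zero]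
      refine Tendsto.neg ?_
      rw [← Finset.sum_const_zero (s := Finset.range d)]
      refine tendsto_finsetSum _ fun j hj => ?_
      obtain ⟨B, hB⟩ := hK.exists_bound_of_continuousOn (hΦ j).continuousOn
      refine Filter.Tendsto.zero_mul_isBoundedUnder_le ?_ ?_ |>.congr fun n => mul_comm _ _
      · have h3 : Tendsto (fun x : ℝ => x ^ j / x ^ d) atTop (𝓝 0) :=
          tendsto_pow_div_pow_atTop_zero (Finset.mem_range.mp hj)
        exact h3.comp ha
      · exact isBoundedUnder_of ⟨B, fun n => hB _ (hYK n)⟩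
    have hcl : MapClusterPt ((Φ (Y m)).coeff d) atTop fun n => (Φ (Y n)).coeff d :=
      (hrec m).continuousAt_comp (hΦ d).continuousAt
    exact eq_of_nhds_neBot (hcl.neBot.mono (inf_le_inf_left _ hlim))

-- The line varies with `n` in the limit argument, which is why continuity of the coefficients and a
-- uniform degree bound are needed.
open Polynomial in
theorem exists_continuous_line_restriction (p : MvPolynomial (Fin 3) ℝ) :
    ∃ Φ : Space3 × Space3 → ℝ[X], (∀ j, Continuous fun z => (Φ z).coeff j) ∧
      (∃ d, ∀ z, ∀ j ≥ d, (Φ z).coeff j = 0) ∧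
      ∀ z s, (Φ z).eval s = MvPolynomial.eval (⇑(z.1 + s • z.2)) p := by
  induction p using MvPolynomial.induction_on with
  | C a =>
    refine ⟨fun _ => C a, fun j => continuous_const, ⟨1, fun z j hj => ?_⟩, by simp⟩
    rw [coeff_C, if_neg (by omega)]
  | add p q hp hq =>
    obtain ⟨Φ, hc, ⟨d, hd⟩, he⟩ := hp
    obtain ⟨Ψ, hc', ⟨d', hd'⟩, he'⟩ := hq
    refine ⟨fun z => Φ z + Ψ z, fun j => ?_, ⟨max d d', fun z j hj => ?_⟩, fun z s => ?_⟩
    · simp only [coeff_add]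
      exact (hc j).add (hc' j)
    · rw [coeff_add, hd z j (le_of_max_le_left hj), hd' z j (le_of_max_le_right hj), add_zero]
    · rw [eval_add, he, he', map_add]
  | mul_X p i hp =>
    obtain ⟨Φ, hc, ⟨d, hd⟩, he⟩ := hp
    refine ⟨fun z => Φ z * C (z.1 i) + Φ z * C (z.2 i) * X, fun j => ?_,
      ⟨d + 1, fun z j hj => ?_⟩, fun z s => ?_⟩
    · rcases j with _ | j
      · simp only [coeff_add, coeff_mul_C, coeff_mul_X_zero, add_zero]
        have := hc 0
        fun_prop
      · simp only [coeff_add, coeff_mul_C, coeff_mul_X]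
        have := hc j
        have := hc (j + 1)
        fun_prop
    · rcases j with _ | j
      · omega
      · rw [coeff_add, coeff_mul_C, coeff_mul_X, coeff_mul_C, hd z _ (by omega),
          hd z _ (by omega)]
        ring
    · simp only [eval_add, eval_mul, eval_C, eval_X, he, map_mul, MvPolynomial.eval_X,
        PiLp.add_apply, PiLp.smul_apply, smul_eq_mul]
      ring

/-- If an algebraic set contains the points `Yₙ + aₙ Zₙ` with `(Y, Z)` bounded and recurrent and
`aₙ → ∞`, then it contains the whole lines `Yₘ + ℝ Zₘ`. -/
theorem IsAlgebraicSet.line_mem_of_recurrent {C : Set Space3} (hC : IsAlgebraicSet C)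
    {Y : ℕ → Space3 × Space3} (hb : Bornology.IsBounded (Set.range Y))
    (hrec : ∀ m, MapClusterPt (Y m) atTop Y) {a : ℕ → ℝ} (ha : Tendsto a atTop atTop)
    (hmem : ∀ n, (Y n).1 + a n • (Y n).2 ∈ C) (m : ℕ) (s : ℝ) : (Y m).1 + s • (Y m).2 ∈ C := by
  rw [hC.mem_iff]
  intro p hp
  obtain ⟨Φ, hc, ⟨d, hd⟩, he⟩ := exists_continuous_line_restriction p
  have := polynomial_eq_zero_of_recurrent hc hb.isCompact_closure
    (fun n => subset_closure (Set.mem_range_self n)) hrec ha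
    (fun n => by rw [he]; exact mem_idealOfSet.mp hp _ (hmem n)) d (fun m => hd (Y m)) m
  rw [← he, this, Polynomial.eval_zero]

/-! ### Orthogonal maps and similarities of three-space. -/

/-- A similarity written with positive ratio and an arbitrary linear isometry. -/
def IsPosSimilarity (f : Space3 → Space3) : Prop :=
  ∃ (r : ℝ) (A : Space3 ≃ₗᵢ[ℝ] Space3) (b : Space3), 0 < r ∧ ∀ x, f x = r • A x + b

theorem Matrix.exists_linearIsometryEquiv {Q : Matrix (Fin 3) (Fin 3) ℝ}
    (hQ : Q.transpose * Q = 1) :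
    ∃ A : Space3 ≃ₗᵢ[ℝ] Space3, ∀ x, Matrix.toEuclideanLin Q x = A x := by
  have hadj : LinearMap.adjoint (Matrix.toEuclideanLin Q) ∘ₗ Matrix.toEuclideanLin Q =
      LinearMap.id := by
    rw [← Matrix.toEuclideanLin_conjTranspose_eq_adjoint, Matrix.conjTranspose_eq_transpose_of_trivial]
    ext1 x
    rw [LinearMap.comp_apply, Matrix.toLpLin_apply, Matrix.toLpLin_apply,
      Matrix.mulVec_mulVec, hQ, Matrix.one_mulVec]
    rfl
  let L : Space3 →ₗᵢ[ℝ] Space3 := ⟨Matrix.toEuclideanLin Q, fun x => by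
    have h1 : ‖Matrix.toEuclideanLin Q x‖ ^ 2 = ‖x‖ ^ 2 := by
      rw [← real_inner_self_eq_norm_sq, ← LinearMap.adjoint_inner_left, ← LinearMap.comp_apply,
        hadj, LinearMap.id_apply, real_inner_self_eq_norm_sq]
    exact (pow_left_inj₀ (norm_nonneg _) (norm_nonneg _) two_ne_zero).mp h1⟩
  exact ⟨L.toLinearIsometryEquiv rfl, fun x => rfl⟩

theorem LinearIsometryEquiv.exists_matrix (A : Space3 ≃ₗᵢ[ℝ] Space3) :
    ∃ Q : Matrix (Fin 3) (Fin 3) ℝ, Q.transpose * Q = 1 ∧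
      ∀ x, Matrix.toEuclideanLin Q x = A x := by
  set Q := Matrix.toEuclideanLin.symm (A.toLinearEquiv : Space3 →ₗ[ℝ] Space3) with hQ
  have hQA : Matrix.toEuclideanLin Q = (A.toLinearEquiv : Space3 →ₗ[ℝ] Space3) := by
    rw [hQ, LinearEquiv.apply_symm_apply]
  refine ⟨Q, ?_, fun x => by rw [hQA]; rfl⟩
  rw [← Matrix.conjTranspose_eq_transpose_of_trivial]
  apply Matrix.toEuclideanLin.injective
  ext1 x
  have h1 : Matrix.toEuclideanLin (Q.conjTranspose * Q) x =
      Matrix.toEuclideanLin Q.conjTranspose (Matrix.toEuclideanLin Q x) := by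
    simp only [Matrix.toLpLin_apply, Matrix.mulVec_mulVec]
  have h2 : Matrix.toEuclideanLin (1 : Matrix (Fin 3) (Fin 3) ℝ) x = x := by
    simp only [Matrix.toLpLin_apply, Matrix.one_mulVec]
  rw [h1, h2, Matrix.toEuclideanLin_conjTranspose_eq_adjoint]
  refine ext_inner_right ℝ fun y => ?_
  rw [LinearMap.adjoint_inner_left, hQA]
  exact A.inner_map_map x y

/-- In dimension three negation has determinant −1, so a sign can be moved between the ratio and the
orthogonal part. -/
theorem isSimilarity_iff {f : Space3 → Space3} : IsSimilarity f ↔ IsPosSimilarity f := by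
  constructor
  · rintro ⟨l, Q, b, hl, hQ, -, hf⟩
    obtain ⟨A, hA⟩ := Matrix.exists_linearIsometryEquiv hQ
    rcases hl.lt_or_gt with h | h
    · refine ⟨-l, A.trans (LinearIsometryEquiv.neg ℝ), b, by linarith, fun x => ?_⟩
      rw [hf, hA]
      simp
    · exact ⟨l, A, b, h, fun x => by rw [hf, hA]⟩
  · rintro ⟨r, A, b, hr, hf⟩
    obtain ⟨Q, hQ, hA⟩ := A.exists_matrix
    have hdet : Q.det * Q.det = 1 := by
      have := congrArg Matrix.det hQ
      rwa [Matrix.det_mul, Matrix.det_transpose, Matrix.det_one] at this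
    rcases mul_self_eq_one_iff.mp hdet with h | h
    · exact ⟨r, Q, b, hr.ne', hQ, h, fun x => by rw [hf, hA]⟩
    · refine ⟨-r, -Q, b, by simpa using hr.ne', by simpa using hQ, ?_, fun x => ?_⟩
      · rw [Matrix.det_neg, h]
        norm_num
      · rw [hf, map_neg, LinearMap.neg_apply, hA, neg_smul_neg]

/-- The square of an orthogonal transformation of three-space has an axis. -/
theorem LinearIsometryEquiv.exists_axis (A : Space3 ≃ₗᵢ[ℝ] Space3) :
    ∃ u : Space3, u ≠ 0 ∧ A (A u) = u := by
  obtain ⟨Q, hQ, hA⟩ := A.exists_matrix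
  have hdet : Q.det * Q.det = 1 := by
    have := congrArg Matrix.det hQ
    rwa [Matrix.det_mul, Matrix.det_transpose, Matrix.det_one] at this
  set B := Q * Q with hB
  have hBB : B.transpose * B = 1 := by
    rw [hB, Matrix.transpose_mul, Matrix.mul_assoc, ← Matrix.mul_assoc Q.transpose Q Q, hQ,
      Matrix.one_mul, hQ]
  have h0 : (B - 1).det = 0 := by
    -- Taking determinants, with `B` of determinant 1 and odd size, shows that `(B - 1).det` equals
    -- its own negative.
    have h1 : B - 1 = (1 - B).transpose * B := by
      rw [Matrix.transpose_sub, Matrix.transpose_one, Matrix.sub_mul, hBB, Matrix.one_mul]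
    have h2 : (1 - B).det = -(B - 1).det := by
      rw [← neg_sub, Matrix.det_neg]
      norm_num
    have h3 := congrArg Matrix.det h1
    rw [Matrix.det_mul, Matrix.det_transpose, h2, hB, Matrix.det_mul, hdet, mul_one] at h3
    linarith
  obtain ⟨v, hv, hBv⟩ := Matrix.exists_mulVec_eq_zero_iff.mpr h0
  refine ⟨WithLp.toLp 2 v, by simpa using hv, ?_⟩
  rw [← hA, ← hA]
  rw [Matrix.sub_mulVec, Matrix.one_mulVec, sub_eq_zero] at hBv
  simp only [Matrix.toLpLin_apply, Matrix.mulVec_mulVec]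
  rw [← hB, hBv]

/-- The orthogonal complement of the fixed plane is an invariant line, on which an isometry acts by
±1. -/
theorem LinearIsometryEquiv.apply_apply_of_fixed_plane (A : Space3 ≃ₗᵢ[ℝ] Space3) {v w : Space3}
    (hlin : LinearIndependent ℝ ![v, w]) (hv : A v = v) (hw : A w = w) (z : Space3) :
    A (A z) = z := by
  set W := Submodule.span ℝ (Set.range ![v, w]) with hW
  have hfin : Module.finrank ℝ Wᗮ = 1 := by
    have h1 := Submodule.finrank_add_finrank_orthogonal W
    rw [hW, finrank_span_eq_card hlin, finrank_euclideanSpace_fin, Fintype.card_fin] at h1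
    rw [hW]
    omega
  have hfix : ∀ y ∈ W, A y = y := by
    intro y hy
    induction hy using Submodule.span_induction with
    | mem x hx =>
      obtain ⟨i, rfl⟩ := hx
      fin_cases i
      · exact hv
      · exact hw
    | zero => exact map_zero A
    | add x y _ _ hx hy => rw [map_add, hx, hy]
    | smul a x _ hx => rw [map_smul, hx]
  have hperp : ∀ y ∈ Wᗮ, A y ∈ Wᗮ := by
    intro y hy
    rw [Submodule.mem_orthogonal] at hy ⊢
    intro x hx
    rw [← hfix x hx, A.inner_map_map]
    exact hy x hx
  obtain ⟨n, hn, hspan⟩ := finrank_eq_one_iff'.mp hfin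
  have hperp2 : ∀ y ∈ Wᗮ, A (A y) = y := by
    have hn' : (n : Space3) ≠ 0 := by simpa using hn
    obtain ⟨c, hc⟩ := hspan ⟨A n, hperp n n.2⟩
    have hc' : A n = c • (n : Space3) := (congrArg Subtype.val hc).symm
    have hcc : c * c = 1 := by
      have h1 := A.norm_map n
      rw [hc', norm_smul, mul_eq_right₀ (norm_ne_zero_iff.mpr hn'), Real.norm_eq_abs] at h1
      rw [← abs_mul_abs_self, h1, one_mul]
    intro y hy
    obtain ⟨d, hd⟩ := hspan ⟨y, hy⟩
    have hd' : y = d • (n : Space3) := (congrArg Subtype.val hd).symm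
    rw [hd', map_smul, map_smul, hc', map_smul, hc', smul_smul c c, hcc, one_smul]
  obtain ⟨y, hy, y', hy', rfl⟩ := W.exists_add_mem_mem_orthogonal z
  rw [map_add, map_add, hfix y hy, hfix y hy, hperp2 y' hy']

/-- An orthogonal transformation of finite order close to the identity is the identity. -/
theorem LinearIsometryEquiv.eq_self_of_iterate_eq (R : Space3 ≃ₗᵢ[ℝ] Space3) {M : ℕ} (hM : 0 < M)
    (hR : ∀ z, R^[M] z = z) {ε : ℝ} (hε : M * ε < 1) (hclose : ∀ z, ‖R z - z‖ ≤ ε * ‖z‖)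
    (v : Space3) : R v = v := by
  set w := R v - v with hw
  have hnorm : ∀ n z, ‖R^[n] z‖ = ‖z‖ := by
    intro n z
    induction n with
    | zero => rfl
    | succ n ih => rw [Function.iterate_succ_apply', R.norm_map, ih]
  have hsub : ∀ n, R^[n] w = R^[n + 1] v - R^[n] v := by
    intro n
    induction n with
    | zero => rfl
    | succ n ih =>
      rw [Function.iterate_succ_apply', ih, map_sub, ← Function.iterate_succ_apply' R,
        ← Function.iterate_succ_apply' R]
  have hdiff : ∀ n : ℕ, ‖R^[n] w - w‖ ≤ n * (ε * ‖w‖) := by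
    intro n
    induction n with
    | zero => simp
    | succ n ih =>
      have h1 : R^[n + 1] w - w = (R (R^[n] w) - R^[n] w) + (R^[n] w - w) := by
        rw [Function.iterate_succ_apply']
        abel
      rw [h1]
      refine (norm_add_le _ _).trans ?_
      have h2 := hclose (R^[n] w)
      rw [hnorm] at h2
      push_cast
      linarith
  -- The sum telescopes over a full period. Yet every term stays close to `w`, so it can vanish only
  -- if `w` does.
  have hsum : ∑ n ∈ Finset.range M, R^[n] w = 0 := by
    simp_rw [hsub]
    rw [Finset.sum_range_sub (fun n => R^[n] v), hR]
    simp
  have hMw : (M : ℝ) * ‖w‖ ≤ M * (M * (ε * ‖w‖)) := by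
    have h1 : (M : ℝ) • w = -∑ n ∈ Finset.range M, (R^[n] w - w) := by
      rw [Finset.sum_sub_distrib, hsum, Finset.sum_const, Finset.card_range, zero_sub, neg_neg,
        Nat.cast_smul_eq_nsmul]
    have h2 : ‖(M : ℝ) • w‖ = M * ‖w‖ := by simp [norm_smul]
    rw [← h2, h1, norm_neg]
    refine (norm_sum_le_of_le _ (f := fun n => R^[n] w - w) (n := fun _ => M * (ε * ‖w‖))
      fun n hn => ?_).trans (by simp)
    refine (hdiff n).trans (mul_le_mul_of_nonneg_right ?_ ((norm_nonneg _).trans (hclose w)))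
    exact_mod_cast (Finset.mem_range.mp hn).le
  have hM' : (0 : ℝ) < M := by exact_mod_cast hM
  have h3 : ‖w‖ ≤ M * (ε * ‖w‖) := le_of_mul_le_mul_left hMw hM'
  have h4 : ‖w‖ = 0 := by
    by_contra hne
    have hpos : 0 < ‖w‖ := lt_of_le_of_ne (norm_nonneg _) (Ne.symm hne)
    nlinarith
  exact sub_eq_zero.mp (norm_eq_zero.mp h4)

theorem IsPosSimilarity.id : IsPosSimilarity fun x => x :=
  ⟨1, LinearIsometryEquiv.refl ℝ _, 0, one_pos, fun x => by simp⟩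

theorem IsPosSimilarity.comp {f g : Space3 → Space3} (hf : IsPosSimilarity f)
    (hg : IsPosSimilarity g) : IsPosSimilarity (f ∘ g) := by
  obtain ⟨r, A, b, hr, hf⟩ := hf
  obtain ⟨r', A', b', hr', hg⟩ := hg
  refine ⟨r * r', A'.trans A, r • A b' + b, mul_pos hr hr', fun x => ?_⟩
  rw [Function.comp_apply, hf, hg, map_add, map_smul, smul_add, smul_smul, add_assoc]
  rfl

theorem IsPosSimilarity.exists_inverse {f : Space3 → Space3} (hf : IsPosSimilarity f) :
    ∃ g, IsPosSimilarity g ∧ Function.LeftInverse g f ∧ Function.RightInverse g f := by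
  obtain ⟨r, A, b, hr, hf⟩ := hf
  refine ⟨fun x => r⁻¹ • A.symm x + -(r⁻¹ • A.symm b), ⟨r⁻¹, A.symm, _, inv_pos.mpr hr,
    fun x => rfl⟩, fun x => ?_, fun x => ?_⟩
  · simp only [hf, map_add, map_smul, A.symm_apply_apply, smul_add, smul_smul,
      inv_mul_cancel₀ hr.ne', one_smul]
    abel
  · simp only [hf, map_add, map_smul, map_neg, A.apply_symm_apply, smul_add, smul_neg, smul_smul,
      mul_inv_cancel₀ hr.ne', one_smul]
    abel

theorem IsPosSimilarity.injective {f : Space3 → Space3} (hf : IsPosSimilarity f) :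
    Function.Injective f := by
  obtain ⟨g, -, hl, -⟩ := hf.exists_inverse
  exact hl.injective

/-- The similarities that leave `C` invariant. -/
def selfSimilarities (C : Set Space3) : Set (Space3 → Space3) :=
  {f | IsPosSimilarity f ∧ f '' C = C}

section SelfSimilarities

variable {C : Set Space3}

theorem comp_mem_selfSimilarities {f g : Space3 → Space3} (hf : f ∈ selfSimilarities C)
    (hg : g ∈ selfSimilarities C) : f ∘ g ∈ selfSimilarities C :=
  ⟨hf.1.comp hg.1, by rw [Set.image_comp, hg.2, hf.2]⟩

theorem iterate_mem_selfSimilarities {f : Space3 → Space3} (hf : f ∈ selfSimilarities C) (n : ℕ) :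
    f^[n] ∈ selfSimilarities C := by
  induction n with
  | zero => exact ⟨IsPosSimilarity.id, Set.image_id C⟩
  | succ n ih => exact comp_mem_selfSimilarities ih hf

theorem exists_inverse_mem_selfSimilarities {f : Space3 → Space3} (hf : f ∈ selfSimilarities C) :
    ∃ g ∈ selfSimilarities C, Function.LeftInverse g f ∧ Function.RightInverse g f := by
  obtain ⟨g, hg, hl, hr⟩ := hf.1.exists_inverse
  refine ⟨g, ⟨hg, ?_⟩, hl, hr⟩
  conv_lhs => rw [← hf.2]
  rw [← Set.image_comp, hl.comp_eq_id, Set.image_id]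

theorem iterate_apply_mem {f : Space3 → Space3} (hf : f ∈ selfSimilarities C) {x : Space3}
    (hx : x ∈ C) (n : ℕ) : f^[n] x ∈ C := by
  rw [← (iterate_mem_selfSimilarities hf n).2]
  exact Set.mem_image_of_mem _ hx

end SelfSimilarities

theorem LinearIsometryEquiv.norm_iterate (A : Space3 ≃ₗᵢ[ℝ] Space3) (n : ℕ) (y : Space3) :
    ‖A^[n] y‖ = ‖y‖ := by
  induction n with
  | zero => rfl
  | succ n ih => rw [Function.iterate_succ_apply', A.norm_map, ih]

theorem LinearIsometryEquiv.isBounded_range_iterate (A : Space3 ≃ₗᵢ[ℝ] Space3) (y : Space3) :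
    Bornology.IsBounded (Set.range fun n => A^[n] y) := by
  refine (Metric.isBounded_closedBall (x := (0 : Space3)) (r := ‖y‖)).subset ?_
  rintro _ ⟨n, rfl⟩
  rw [mem_closedBall_zero_iff, A.norm_iterate]

/-- An affine isometry is, about a suitable center, a linear isometry followed by a translation
along a fixed vector. -/
theorem LinearIsometryEquiv.exists_screw_center (A : Space3 ≃ₗᵢ[ℝ] Space3) (b : Space3) :
    ∃ c t : Space3, A t = t ∧ A c + b = c + t := by
  let N : Space3 →ₗ[ℝ] Space3 := (A.toLinearEquiv : Space3 →ₗ[ℝ] Space3) - LinearMap.id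
  have hN : ∀ x, N x = A x - x := fun x => rfl
  -- The component of `b` in the range of `A - 1` is absorbed by moving the center; the orthogonal
  -- component is fixed by `A`.
  obtain ⟨y, ⟨w, rfl⟩, t, ht, rfl⟩ := (LinearMap.range N).exists_add_mem_mem_orthogonal b
  refine ⟨-w, t, ?_, ?_⟩
  · have h1 : inner ℝ (A t - t) t = (0 : ℝ) :=
      (Submodule.mem_orthogonal _ _).mp ht _ ⟨t, hN t⟩
    rw [inner_sub_left, real_inner_self_eq_norm_sq] at h1
    have h2 : ‖A t - t‖ ^ 2 = 0 := by
      rw [norm_sub_sq_real, A.norm_map]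
      linarith
    exact sub_eq_zero.mp (norm_eq_zero.mp (pow_eq_zero_iff two_ne_zero |>.mp h2))
  · rw [hN, map_neg]
    abel

/-- A similarity with ratio different from one has a fixed point. -/
theorem LinearIsometryEquiv.exists_fixed_point (A : Space3 ≃ₗᵢ[ℝ] Space3) {r : ℝ} (hr : 1 < r)
    (b : Space3) : ∃ c : Space3, r • A c + b = c := by
  let N : Space3 →ₗ[ℝ] Space3 := LinearMap.id - r • (A.toLinearEquiv : Space3 →ₗ[ℝ] Space3)
  have hN : ∀ x, N x = x - r • A x := fun x => rfl
  have hinj : Function.Injective N := by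
    rw [injective_iff_map_eq_zero]
    intro x hx
    rw [hN, sub_eq_zero] at hx
    have h1 := congrArg norm hx
    rw [norm_smul, A.norm_map, Real.norm_of_nonneg (by linarith)] at h1
    by_contra hne
    have := norm_pos_iff.mpr hne
    nlinarith
  obtain ⟨c, hc⟩ := LinearMap.injective_iff_surjective.mp hinj b
  exact ⟨c, by rw [← hc, hN]; abel⟩

/-! ### Self-similarities of a curve: isometries, bounded order, finiteness. -/

namespace IsIrreducibleAlgebraicCurve

variable {C : Set Space3}

/-- About its fixed point `c`, an expanding map sends `x` to `c + r ^ n • A^[n] (x - c)`: the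
directions recur while the distances diverge, so `C` contains a line. -/
theorem ratio_le_one (hC : IsIrreducibleAlgebraicCurve C) (hline : ¬ IsStraightLine C)
    {f : Space3 → Space3} (hf : f ∈ selfSimilarities C) {r : ℝ} {A : Space3 ≃ₗᵢ[ℝ] Space3}
    {b : Space3} (hfx : ∀ x, f x = r • A x + b) : r ≤ 1 := by
  by_contra! hr
  obtain ⟨c, hc⟩ := A.exists_fixed_point hr b
  have hiter : ∀ (n : ℕ) (y : Space3), f^[n] (c + y) = c + r ^ n • A^[n] y := by
    intro n y
    induction n with
    | zero => simp
    | succ n ih =>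
      rw [Function.iterate_succ_apply', ih, hfx, map_add, map_smul, smul_add, smul_smul,
        ← pow_succ', Function.iterate_succ_apply']
      conv_rhs => rw [← hc]
      abel
  obtain ⟨x, hx, hxc⟩ : ∃ x ∈ C, x ≠ c := by
    by_contra! h
    exact hC.infinite ((Set.finite_singleton c).subset h)
  refine hline (hC.isStraightLine_of_line_subset (x₀ := c) (sub_ne_zero.mpr hxc) fun s => ?_)
  refine hC.isAlgebraic.line_mem_of_recurrent (Y := fun n => (c, A^[n] (x - c))) ?_ (fun m => ?_)
    (tendsto_pow_atTop_atTop_of_one_lt hr) (fun n => ?_) 0 s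
  · refine (Bornology.isBounded_singleton (x := c)).prod (A.isBounded_range_iterate (x - c))
      |>.subset ?_
    rintro _ ⟨n, rfl⟩
    exact ⟨rfl, n, rfl⟩
  · exact (A.isometry.mapClusterPt_iterate (A.isBounded_range_iterate (x - c)) m).continuousAt_comp
      (f := fun y => (c, y)) (by fun_prop)
  · rw [← hiter]
    exact iterate_apply_mem hf (by simpa using hx) n

/-- The bound on the ratio also applies to the inverse, and the two ratios multiply to one. -/
theorem ratio_eq_one (hC : IsIrreducibleAlgebraicCurve C) (hline : ¬ IsStraightLine C)
    {f : Space3 → Space3} (hf : f ∈ selfSimilarities C) :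
    ∃ (A : Space3 ≃ₗᵢ[ℝ] Space3) (b : Space3), ∀ x, f x = A x + b := by
  obtain ⟨r, A, b, hr, hfx⟩ := hf.1
  obtain ⟨g, hg, hl, -⟩ := exists_inverse_mem_selfSimilarities hf
  obtain ⟨r', A', b', hr', hgx⟩ := hg.1
  have h1 := hC.ratio_le_one hline hf hfx
  have h2 := hC.ratio_le_one hline hg hgx
  have h3 : r' * r = 1 := by
    obtain ⟨u, hu⟩ := exists_ne (0 : Space3)
    have e1 := hl u
    have e2 := hl 0
    rw [hgx, hfx, map_add, map_smul] at e1 e2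
    rw [map_zero, map_zero, smul_zero, zero_add] at e2
    have e3 : r' • r • A' (A u) = u := by
      rw [smul_add, add_assoc, e2, add_zero] at e1
      exact e1
    have e4 := congrArg norm e3
    rw [norm_smul, norm_smul, A'.norm_map, A.norm_map, Real.norm_of_nonneg hr'.le,
      Real.norm_of_nonneg hr.le, ← mul_assoc] at e4
    exact (mul_eq_right₀ (norm_ne_zero_iff.mpr hu)).mp e4
  have h4 : r = 1 := by nlinarith
  exact ⟨A, b, fun x => by rw [hfx, h4, one_smul]⟩

/-- A nonzero translation part `t` of the screw motion would carry orbits to infinity at bounded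
distance from a line, and `C` would contain a line parallel to `t`. -/
theorem exists_fixed_point (hC : IsIrreducibleAlgebraicCurve C) (hline : ¬ IsStraightLine C)
    {f : Space3 → Space3} (hf : f ∈ selfSimilarities C) :
    ∃ (A : Space3 ≃ₗᵢ[ℝ] Space3) (c : Space3), ∀ y, f (c + y) = c + A y := by
  obtain ⟨A, b, hfx⟩ := hC.ratio_eq_one hline hf
  obtain ⟨c, t, ht, hc⟩ := A.exists_screw_center b
  have hstep : ∀ y, f (c + y) = c + (A y + t) := by
    intro y
    rw [hfx, map_add, add_right_comm, hc]
    abel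
  have hiter : ∀ (n : ℕ) (y : Space3), f^[n] (c + y) = c + A^[n] y + (n : ℝ) • t := by
    intro n y
    induction n with
    | zero => simp
    | succ n ih =>
      rw [Function.iterate_succ_apply', ih, add_assoc, hstep, map_add, map_smul, ht,
        Function.iterate_succ_apply']
      push_cast
      module
  obtain ⟨x, hx⟩ := hC.isIrreducible.1
  refine ⟨A, c, fun y => ?_⟩
  suffices t = 0 by rw [hstep, this, add_zero]
  by_contra ht0
  refine hline (hC.isStraightLine_of_line_subset (x₀ := x) ht0 fun s => ?_)
  have hb : Bornology.IsBounded (Set.range fun n => c + A^[n] (x - c)) := by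
    refine (Metric.isBounded_closedBall (x := c) (r := ‖x - c‖)).subset ?_
    rintro _ ⟨n, rfl⟩
    rw [mem_closedBall_iff_norm, add_sub_cancel_left, A.norm_iterate]
  have := hC.isAlgebraic.line_mem_of_recurrent (Y := fun n => (c + A^[n] (x - c), t)) ?_
    (fun m => ?_) tendsto_natCast_atTop_atTop (fun n => ?_) 0 s
  · simpa using this
  · refine (hb.prod (Bornology.isBounded_singleton (x := t))).subset ?_
    rintro _ ⟨n, rfl⟩
    exact ⟨⟨n, rfl⟩, rfl⟩
  · exact (A.isometry.mapClusterPt_iterate (A.isBounded_range_iterate (x - c)) m).continuousAt_comp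
      (f := fun y => (c + y, t)) (by fun_prop)
  · rw [← hiter]
    exact iterate_apply_mem hf (by simpa using hx) n

theorem exists_linearIndependent (hC : IsIrreducibleAlgebraicCurve C)
    (hline : ¬ IsStraightLine C) (x₀ : Space3) :
    ∃ x ∈ C, ∃ y ∈ C, LinearIndependent ℝ ![x - x₀, y - x₀] := by
  obtain ⟨x, hx, hxx⟩ : ∃ x ∈ C, x ≠ x₀ := by
    by_contra! h
    exact hC.infinite ((Set.finite_singleton x₀).subset h)
  have hv : x - x₀ ≠ 0 := sub_ne_zero.mpr hxx
  by_contra! hcon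
  refine hline (hC.isStraightLine_of_subset_line (x₀ := x₀) hv fun y hy => ?_)
  have := hcon x hx y hy
  rw [LinearIndependent.pair_iff' hv] at this
  push Not at this
  obtain ⟨s, hs⟩ := this
  exact ⟨s, by rw [hs]; abel⟩

/-- The self-similarities of a curve have uniformly bounded order. -/
theorem exists_iterate_eq (hC : IsIrreducibleAlgebraicCurve C) (hline : ¬ IsStraightLine C)
    (hcircle : ¬ IsSpaceCircle C) :
    ∃ M : ℕ, 0 < M ∧ ∀ f ∈ selfSimilarities C, ∀ x, f^[M] x = x := by
  classical
  obtain ⟨D, hD⟩ := hC.exists_card_quadric_inter_le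
  -- The first 2 passes to the square, which has an axis; the factorial is a multiple of every
  -- period up to `D`; the last 2 removes a possible reflection in a plane fixed pointwise.
  refine ⟨2 * D.factorial * 2, by positivity, fun f hf => ?_⟩
  have hh := iterate_mem_selfSimilarities hf 2
  set h := f^[2] with hhdef
  obtain ⟨A, c, hA⟩ := hC.exists_fixed_point hline hf
  obtain ⟨u, hu, hAu⟩ := A.exists_axis
  have hhA : ∀ x, h x = c + A (A (x - c)) := by
    intro x
    have h1 : h x = f (f (c + (x - c))) := by rw [add_sub_cancel]; rfl
    rw [h1, hA, hA]
  have hinner : ∀ n x, inner ℝ u (h^[n] x) = (inner ℝ u x : ℝ) := by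
    intro n x
    induction n with
    | zero => rfl
    | succ n ih =>
      rw [Function.iterate_succ_apply', hhA, inner_add_right]
      nth_rw 2 [← hAu]
      rw [A.inner_map_map, A.inner_map_map, inner_sub_right, ih]
      ring
  have hnorm : ∀ n x, ‖h^[n] x - c‖ = ‖x - c‖ := by
    intro n x
    induction n with
    | zero => rfl
    | succ n ih =>
      rw [Function.iterate_succ_apply', hhA, add_sub_cancel_left, A.norm_map, A.norm_map, ih]
  have hexp : ∀ x : Space3, ‖x - c‖ ^ 2 = ‖x‖ ^ 2 + inner ℝ ((-2 : ℝ) • c) x + ‖c‖ ^ 2 := by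
    intro x
    rw [norm_sub_sq_real, inner_smul_left, real_inner_comm]
    simp
    ring
  have hfixC : ∀ x ∈ C, h^[D.factorial] x = x := by
    intro x hx
    -- If the first `D + 1` orbit points were distinct, the bound `D` would put all of `C` in the
    -- plane normal to the axis and in the sphere about `c` that contain them.
    have hnot : ¬ Set.InjOn (fun n => h^[n] x) (Finset.range (D + 1) : Set ℕ) := by
      intro hinj
      have hcard : D < ((Finset.range (D + 1)).image fun n => h^[n] x).card := by
        rw [Finset.card_image_of_injOn hinj, Finset.card_range]
        exact Nat.lt_succ_self D
      have hsub : (((Finset.range (D + 1)).image fun n => h^[n] x : Finset Space3) :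
          Set Space3) ⊆ C := by
        intro y hy
        obtain ⟨n, -, rfl⟩ := Finset.mem_image.mp (Finset.mem_coe.mp hy)
        exact iterate_apply_mem hh hx n
      refine hcircle (hC.isSpaceCircle_of_subset (u := u) (c := c) (β := inner ℝ u x)
        (ρ := ‖x - c‖ ^ 2) hu (fun y hy => ?_) fun y hy => ?_)
      · have := hD 0 u (-inner ℝ u x) _ hsub (fun z hz => by
          obtain ⟨n, -, rfl⟩ := Finset.mem_image.mp hz
          rw [hinner]
          ring) hcard y hy
        linarith
      · have := hD 1 ((-2 : ℝ) • c) (‖c‖ ^ 2 - ‖x - c‖ ^ 2) _ hsub (fun z hz => by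
          obtain ⟨n, -, rfl⟩ := Finset.mem_image.mp hz
          have := hexp (h^[n] x)
          rw [hnorm] at this
          linarith) hcard y hy
        rw [hexp]
        linarith
    have hper : ∃ m, 0 < m ∧ m ≤ D ∧ h^[m] x = x := by
      rw [Set.InjOn] at hnot
      push Not at hnot
      obtain ⟨i, hi, j, hj, hij, hne⟩ := hnot
      have key : ∀ i j, i < j → j < D + 1 → h^[i] x = h^[j] x →
          ∃ m, 0 < m ∧ m ≤ D ∧ h^[m] x = x := by
        intro i j hlt hj hij
        refine ⟨j - i, by omega, by omega, (hh.1.injective.iterate i) ?_⟩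
        rw [← Function.iterate_add_apply, show i + (j - i) = j by omega, hij]
      rw [Finset.mem_coe, Finset.mem_range] at hi hj
      rcases hne.lt_or_gt with hlt | hlt
      · exact key i j hlt hj hij
      · exact key j i hlt hi hij.symm
    obtain ⟨m, hm, hmD, hmx⟩ := hper
    exact Function.IsPeriodicPt.trans_dvd (f := h) (x := x) hmx (Nat.dvd_factorial hm hmD)
  have hk := iterate_mem_selfSimilarities hh D.factorial
  obtain ⟨K, b, hK⟩ := hC.ratio_eq_one hline hk
  obtain ⟨x₀, hx₀⟩ := hC.isIrreducible.1
  have hK' : ∀ x, h^[D.factorial] x = x₀ + K (x - x₀) := by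
    intro x
    have h1 := hfixC x₀ hx₀
    rw [hK] at h1
    rw [hK, map_sub, eq_sub_of_add_eq' h1]
    abel
  have hKC : ∀ x ∈ C, K (x - x₀) = x - x₀ := by
    intro x hx
    have h1 := hfixC x hx
    rw [hK'] at h1
    exact eq_sub_of_add_eq' h1
  obtain ⟨x, hx, y, hy, hxy⟩ := hC.exists_linearIndependent hline x₀
  intro z
  rw [Function.iterate_mul, Function.iterate_mul, ← hhdef]
  change h^[D.factorial] (h^[D.factorial] z) = z
  rw [hK', hK' z, add_sub_cancel_left,
    K.apply_apply_of_fixed_plane hxy (hKC x hx) (hKC y hy), add_sub_cancel]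

theorem finite_selfSimilarities (hC : IsIrreducibleAlgebraicCurve C)
    (hline : ¬ IsStraightLine C) (hcircle : ¬ IsSpaceCircle C) :
    (selfSimilarities C).Finite := by
  obtain ⟨M, hM, hMf⟩ := hC.exists_iterate_eq hline hcircle
  have hM' : (0 : ℝ) < M := by exact_mod_cast hM
  have hex : ∀ f ∈ selfSimilarities C, ∃ (A : Space3 ≃ₗᵢ[ℝ] Space3) (b : Space3),
      ∀ x, f x = A x + b := fun f hf => hC.ratio_eq_one hline hf
  choose! A b hA using hex
  have htrans : ∀ f ∈ selfSimilarities C, ∀ d : Space3, (∀ x, f x = x + d) → d = 0 := by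
    intro f hf d hd
    have hiter : ∀ n : ℕ, f^[n] 0 = (n : ℝ) • d := by
      intro n
      induction n with
      | zero => simp
      | succ n ih =>
        rw [Function.iterate_succ_apply', ih, hd]
        push_cast
        module
    have h1 := hMf f hf 0
    rw [hiter] at h1
    exact (smul_eq_zero.mp h1).resolve_left hM'.ne'
  have hfaith : ∀ f ∈ selfSimilarities C, (∀ x, A f x = x) → ∀ x, f x = x := by
    intro f hf h x
    have h1 : ∀ x, f x = x + b f := fun x => by rw [hA f hf, h]
    rw [h1, htrans f hf _ h1, add_zero]
  -- The linear part of the quotient of `f` by `g` has order dividing `M` and is close to the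
  -- identity, hence trivial; the remaining translation has finite order, so it is zero.
  have hquot : ∀ f ∈ selfSimilarities C, ∀ g ∈ selfSimilarities C,
      (∀ z, ‖A f z - A g z‖ ≤ 1 / (2 * M) * ‖z‖) → f = g := by
    intro f hf g hg hclose
    obtain ⟨g', hg', hl, hr⟩ := exists_inverse_mem_selfSimilarities hg
    have hk := comp_mem_selfSimilarities hg' hf
    have hlin : ∀ z, A g (A (g' ∘ f) z) = A f z := by
      intro z
      have e : ∀ x, A g (A (g' ∘ f) x + b (g' ∘ f)) + b g = A f x + b f := by
        intro x
        rw [← hA _ hk, ← hA g hg, ← hA f hf]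
        exact hr (f x)
      have e1 := e z
      have e2 := e 0
      rw [map_add] at e1 e2
      rw [map_zero, map_zero, map_zero, zero_add, zero_add] at e2
      rw [← e2, add_assoc] at e1
      exact add_right_cancel e1
    have hone : ∀ z, A (g' ∘ f) z = z := by
      refine (A (g' ∘ f)).eq_self_of_iterate_eq hM (fun z => ?_) (ε := 1 / (2 * M)) ?_ fun z => ?_
      · have hiter : ∀ n, (g' ∘ f)^[n] z - (g' ∘ f)^[n] 0 = (A (g' ∘ f))^[n] z := by
          intro n
          induction n with
          | zero => simp
          | succ n ih =>
            rw [Function.iterate_succ_apply', Function.iterate_succ_apply',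
              Function.iterate_succ_apply', ← ih, hA _ hk, hA _ hk, map_sub]
            abel
        rw [← hiter, hMf _ hk, hMf _ hk, sub_zero]
      · field_simp
        norm_num
      · rw [← (A g).norm_map, map_sub, hlin]
        exact hclose z
    have hid := hfaith _ hk hone
    funext x
    rw [← hr (f x)]
    exact congrArg g (hid x)
  let Λ : (Space3 → Space3) → (Space3 →L[ℝ] Space3) := fun f =>
    (A f).toContinuousLinearEquiv.toContinuousLinearMap
  have hbdd : Bornology.IsBounded (Λ '' selfSimilarities C) := by
    refine (Metric.isBounded_closedBall (x := (0 : Space3 →L[ℝ] Space3)) (r := 1)).subset ?_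
    rintro _ ⟨f, -, rfl⟩
    rw [mem_closedBall_zero_iff]
    exact ContinuousLinearMap.opNorm_le_bound _ zero_le_one fun z => by
      rw [one_mul]
      exact ((A f).norm_map z).le
  -- Two maps in one ball of radius `1 / (4 * M)` differ by at most `1 / (2 * M)`, the separation
  -- required above.
  obtain ⟨t, ht, hcover⟩ := Metric.totallyBounded_iff.mp
    hbdd.isCompact_closure.totallyBounded (1 / (4 * M)) (by positivity)
  by_contra hinf
  have hcov : ∀ f ∈ selfSimilarities C, ∃ y ∈ t, dist (Λ f) y < 1 / (4 * M) := by
    intro f hf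
    obtain ⟨y, hy, hfy⟩ := Set.mem_iUnion₂.mp
      (hcover (subset_closure (Set.mem_image_of_mem Λ hf)))
    exact ⟨y, hy, hfy⟩
  choose! y hy hdist using hcov
  obtain ⟨f, hf, g, hg, hne, hfg⟩ :=
    Set.Infinite.exists_ne_map_eq_of_mapsTo (f := y) (t := t) hinf hy ht
  refine hne (hquot f hf g hg fun z => ?_)
  have h1 : ‖Λ f - Λ g‖ ≤ 1 / (2 * M) := by
    rw [← dist_eq_norm]
    have e1 := hdist f hf
    have e2 := hdist g hg
    rw [hfg] at e1
    have e3 := dist_triangle_right (Λ f) (Λ g) (y g)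
    have e4 : (1 : ℝ) / (2 * M) = 1 / (4 * M) + 1 / (4 * M) := by field_simp; norm_num
    linarith
  exact ((Λ f - Λ g).le_opNorm z).trans (mul_le_mul_of_nonneg_right h1 (norm_nonneg z))

/-- A curve other than a line or a circle is symmetric if and only if it has a nontrivial
self-similarity. -/
theorem isSymmetric_iff (hC : IsIrreducibleAlgebraicCurve C) (hline : ¬ IsStraightLine C) :
    IsSymmetric C ↔ ∃ f ∈ selfSimilarities C, f ≠ id := by
  constructor
  · rintro ⟨g, hg, hgC⟩
    refine ⟨g, ⟨⟨1, g.linearIsometryEquiv, g 0, one_pos, fun x => ?_⟩, hgC⟩, fun h => hg ?_⟩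
    · have := g.map_vadd 0 x
      simpa using this
    · ext1 x
      exact congrFun h x
  · rintro ⟨f, hf, hne⟩
    obtain ⟨A, b, hA⟩ := hC.ratio_eq_one hline hf
    let g : Space3 ≃ᵃⁱ[ℝ] Space3 :=
      A.toAffineIsometryEquiv.trans (AffineIsometryEquiv.constVAdd ℝ Space3 b)
    have hg : ⇑g = f := by
      funext x
      rw [hA, add_comm]
      rfl
    refine ⟨g, fun h => hne ?_, by rw [hg, hf.2]⟩
    rw [← hg, h]
    rfl

end IsIrreducibleAlgebraicCurve

/-! ### The main theorem. -/

theorem mainTheorem6 (C₁ C₂ : Set Space3)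
    (hC₁ : IsIrreducibleAlgebraicCurve C₁) (hC₂ : IsIrreducibleAlgebraicCurve C₂)
    (hline₁ : ¬ IsStraightLine C₁) (hcircle₁ : ¬ IsSpaceCircle C₁)
    (hline₂ : ¬ IsStraightLine C₂) (hcircle₂ : ¬ IsSpaceCircle C₂)
    (hsim : AreSimilar C₁ C₂) :
    {f : Space3 → Space3 | IsSimilarityBetween C₁ C₂ f}.Finite ∧
    ((∃! f : Space3 → Space3, IsSimilarityBetween C₁ C₂ f) ↔
      (¬ IsSymmetric C₁ ∧ ¬ IsSymmetric C₂)) := by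
  have hbetween : ∀ f, IsSimilarityBetween C₁ C₂ f ↔ IsPosSimilarity f ∧ f '' C₁ = C₂ :=
    fun f => and_congr_left' isSimilarity_iff
  obtain ⟨f₀, hf₀⟩ := hsim
  have hf₀' := (hbetween f₀).mp hf₀
  obtain ⟨g₀, hg₀, hl, hr⟩ := hf₀'.1.exists_inverse
  have hg₀C : g₀ '' C₂ = C₁ := by
    rw [← hf₀'.2, ← Set.image_comp, hl.comp_eq_id, Set.image_id]
  have hself : ∀ f, IsSimilarityBetween C₁ C₂ f → g₀ ∘ f ∈ selfSimilarities C₁ := by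
    intro f hf
    rw [hbetween] at hf
    exact ⟨hg₀.comp hf.1, by rw [Set.image_comp, hf.2, hg₀C]⟩
  have hinj : Function.Injective fun f : Space3 → Space3 => g₀ ∘ f :=
    fun f f' h => funext fun x => hr.injective (congrFun h x)
  refine ⟨?_, ?_⟩
  · exact Set.Finite.of_injOn (f := fun f : Space3 → Space3 => g₀ ∘ f) hself hinj.injOn
      (hC₁.finite_selfSimilarities hline₁ hcircle₁)
  rw [hC₁.isSymmetric_iff hline₁, hC₂.isSymmetric_iff hline₂]
  push Not
  constructor
  -- A nontrivial self-similarity of either curve, composed with `f₀` on the appropriate side, would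
  -- give a second similarity.
  · intro huniq
    refine ⟨fun f hf => ?_, fun f hf => ?_⟩
    · have h1 : IsSimilarityBetween C₁ C₂ (f₀ ∘ f) :=
        (hbetween _).mpr ⟨hf₀'.1.comp hf.1, by rw [Set.image_comp, hf.2, hf₀'.2]⟩
      have h2 := huniq.unique h1 hf₀
      funext x
      exact hl.injective (congrFun h2 x)
    · have h1 : IsSimilarityBetween C₁ C₂ (f ∘ f₀) :=
        (hbetween _).mpr ⟨hf.1.comp hf₀'.1, by rw [Set.image_comp, hf₀'.2, hf.2]⟩
      have h2 := huniq.unique h1 hf₀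
      funext x
      have h3 := congrFun h2 (g₀ x)
      rw [Function.comp_apply, hr x] at h3
      exact h3
  · rintro ⟨h₁, -⟩
    refine ⟨f₀, hf₀, fun f hf => hinj ?_⟩
    change g₀ ∘ f = g₀ ∘ f₀
    rw [h₁ _ (hself f hf), hl.comp_eq_id]
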